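/- Let $\Gamma$ be a finitely generated group with a fixed finite symmetric generating set, let $|\cdot|$ be the associated word length and $B_n=\{g\in\Gamma: |g|\le n\}$. Let $\lambda$ denote the left regular representation of $\mathbb{C}\Gamma$ on $\ell^2(\Gamma)$ and put $$\rho(n)=\max\Big\{\frac{\|\lambda(f)\|}{\|f\|_2} : 0\ne f\in\mathbb{C}\Gamma,\ \mathrm{supp}(f)\subseteq B_n\Big\}.$$ A function $\phi:\mathbb{N}\to[0,\infty)$ grows polynomially if $\phi(n)\le p(n)$ for all $n$, for some real polynomial $p$; it grows subexponentially if for every $b>1$ there is a constant $C$ with $\phi(n)\le C\,b^n$ for all $n$. The group $\Gamma$ has rapid decay (RD) if $\rho$ grows polynomially, and semi-rapid decay (SRD) if $\rho$ grows subexponentially. Let $\mathrm{PC}(\Gamma)$ (resp. $\mathrm{SEC}(\Gamma)$) be the set of all $g\in\Gamma$ with conjugacy class $\mathrm{Cl}(g)$ such that $n\mapsto|\mathrm{Cl}(g)\cap B_n|$ grows polynomially (resp. subexponentially). Let $\mathrm{Rad}(\Gamma)$ be the amenable radical of $\Gamma$, i.e. its largest amenable normal subgroup (the subgroup generated by all amenable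 normal subgroups). If $\Gamma$ has SRD, then $\mathrm{SEC}(\Gamma)=\mathrm{Rad}(\Gamma)$. If $\Gamma$ has RD, then $\mathrm{PC}(\Gamma)=\mathrm{SEC}(\Gamma)=\mathrm{Rad}(\Gamma)$. -/

import Mathlib

open scoped ENNReal

noncomputable section

namespace RapidDecay

/-! ### Growth types of real functions on the natural numbers -/

/-- `f` grows (at most) polynomially. -/
def GrowsPolynomially (f : ℕ → ℝ) : Prop :=
  ∃ p : Polynomial ℝ, ∀ n : ℕ, f n ≤ p.eval (n : ℝ)

/-- `f` grows subexponentially: it is dominated by every exponential `n ↦ b ^ n` with `b > 1`. -/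
def GrowsSubexponentially (f : ℕ → ℝ) : Prop :=
  ∀ b : ℝ, 1 < b → ∃ C : ℝ, ∀ n : ℕ, f n ≤ C * b ^ n

/-! ### Amenability and the amenable radical -/

/-- A discrete group is amenable if `ℓ^∞(G, ℝ)` carries a left-invariant mean. -/
def IsAmenable (G : Type*) [Group G] : Prop :=
  ∃ m : lp (fun _ : G => ℝ) ∞ →ₗ[ℝ] ℝ,
    (∀ f : lp (fun _ : G => ℝ) ∞, (∀ x, 0 ≤ f x) → 0 ≤ m f) ∧
    m 1 = 1 ∧
    ∀ (g : G) (f f' : lp (fun _ : G => ℝ) ∞), (∀ x, f' x = f (g * x)) → m f' = m f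

/-- The amenable radical: the subgroup generated by all amenable normal subgroups, that is,
the largest amenable normal subgroup. -/
def amenableRadical (Γ : Type*) [Group Γ] : Subgroup Γ :=
  sSup {N : Subgroup Γ | N.Normal ∧ IsAmenable N}

section

variable {Γ : Type*} [Group Γ]

/-! ### The left regular representation -/

/-- Left translates of square-summable functions are square-summable. -/
theorem memℓp_translate (g : Γ) (ξ : lp (fun _ : Γ => ℂ) 2) :
    Memℓp (fun x => ξ (g⁻¹ * x)) 2 := by
  have h := (memℓp_gen_iff (p := 2) (by norm_num)).1 (lp.memℓp ξ)
  exact (memℓp_gen_iff (p := 2) (by norm_num)).2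
    (h.comp_injective (mul_right_injective g⁻¹))

/-- The unitary `λ_g` on `ℓ²(Γ)`, `(λ_g ξ)(x) = ξ (g⁻¹ x)`. -/
def regRep (g : Γ) : lp (fun _ : Γ => ℂ) 2 →ₗᵢ[ℂ] lp (fun _ : Γ => ℂ) 2 where
  toFun ξ := ⟨fun x => ξ (g⁻¹ * x), memℓp_translate g ξ⟩
  map_add' _ _ := rfl
  map_smul' _ _ := rfl
  norm_map' ξ := by
    have h2 : 0 < (2 : ℝ≥0∞).toReal := by norm_num
    rw [lp.norm_eq_tsum_rpow h2, lp.norm_eq_tsum_rpow h2]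
    congr 1
    exact (Equiv.mulLeft g⁻¹).tsum_eq (fun x => ‖ξ x‖ ^ (2 : ℝ≥0∞).toReal)

/-- The operator `λ(f) = ∑ f(g) λ_g` on `ℓ²(Γ)`, for `f` in the complex group algebra. -/
def regRepAlg (f : MonoidAlgebra ℂ Γ) :
    lp (fun _ : Γ => ℂ) 2 →L[ℂ] lp (fun _ : Γ => ℂ) 2 :=
  f.coeff.sum fun g c => c • (regRep g).toContinuousLinearMap

/-- The `ℓ²`-norm of an element of the complex group algebra. -/
def twoNorm (f : MonoidAlgebra ℂ Γ) : ℝ :=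
  Real.sqrt (f.coeff.sum fun _ c => ‖c‖ ^ 2)

/-! ### Growth functions with respect to a generating set -/

/-- The ball of radius `n` around `1`: the products of at most `n` elements of `S`
(meant for a symmetric generating set `S`). -/
def ball (S : Finset Γ) (n : ℕ) : Set Γ :=
  {g | ∃ l : List Γ, (∀ s ∈ l, s ∈ S) ∧ l.length ≤ n ∧ l.prod = g}

/-- The growth function `α_A(n) = |A ∩ B_n|` of a subset `A`. -/
def growth (S : Finset Γ) (A : Set Γ) (n : ℕ) : ℝ :=
  ((A ∩ ball S n).ncard : ℝ)

/-- The function `ρ(n) = max ‖λ(f)‖ / ‖f‖₂` over all nonzero `f` in the complex group algebra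
that are supported in `B_n`. -/
def rho (S : Finset Γ) (n : ℕ) : ℝ :=
  sSup {r : ℝ | ∃ f : MonoidAlgebra ℂ Γ, f ≠ 0 ∧ (f.coeff.support : Set Γ) ⊆ ball S n ∧
    r = ‖regRepAlg f‖ / twoNorm f}

/-- Rapid decay. -/
def HasRD (S : Finset Γ) : Prop :=
  GrowsPolynomially (rho S)

/-- Semi-rapid decay. -/
def HasSRD (S : Finset Γ) : Prop :=
  GrowsSubexponentially (rho S)

/-- The elements whose conjugacy class grows polynomially. -/
def PC (S : Finset Γ) : Set Γ :=
  {g | GrowsPolynomially (growth S (conjugatesOf g))}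

/-- The elements whose conjugacy class grows subexponentially. -/
def SEC (S : Finset Γ) : Set Γ :=
  {g | GrowsSubexponentially (growth S (conjugatesOf g))}

end

end RapidDecay

end

/-!
The chain `PC S ⊆ SEC S ⊆ Rad(Γ)` is closed up by bounding the growth of the conjugacy classes in
the amenable radical through `rho`.

`SEC S ⊆ Rad(Γ)` (`SEC_subset_amenableRadical`): let the conjugacy class of `g` grow
subexponentially and let `H` be generated by a finite set `F` of conjugates of `g`. Conjugating the
tuple `(c)_{c ∈ F}` by an element of `H` determines this element modulo the centre of `H`, and the
entries of the resulting tuple are conjugates of `g` whose word length is bounded linearly. Hence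
the quotient of `H` by its centre has subexponential growth, so it is amenable, and `H` is amenable
as an extension of it by an abelian group (`isAmenable_closure_of_mem_SEC`). The normal closure of
`g` is the directed union of these groups `H`, so it is an amenable normal subgroup.

`Rad(Γ) ⊆ SEC S`, and `Rad(Γ) ⊆ PC S` under rapid decay: joins of amenable normal subgroups are
amenable, so an element `g` of the radical lies in an amenable normal subgroup `N`, which contains
the conjugacy class of `g`. For finite `A ⊆ N`, almost invariant unit vectors in `ℓ²` show that
`‖λ(1_A)‖ ≥ |A|` (`IsAmenable.card_le_norm`). For the part `A` of the conjugacy class in the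
`n`-ball this gives `|A| ≤ ‖λ(1_A)‖ ≤ rho S n * √|A|`, that is, `|A| ≤ rho S n ^ 2`
(`growth_conjugatesOf_le_rho_sq`), and squaring preserves both growth types.

Amenability enters through means on `ℓ^∞`. Means are constructed as weak-* limit points of explicit
averages (`IsMean.exists_limit`), and a mean is turned into almost invariant probability measures by
the Hahn–Banach theorem (`IsAmenable.exists_almost_invariant`).
-/

open scoped ENNReal
open Filter Topology

noncomputable section

namespace RapidDecay


/-! ### Means on bounded functions -/

/-- A mean on `X`: a positive unital linear functional on `ℓ^∞(X, ℝ)`. -/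
structure IsMean {X : Type*} (m : lp (fun _ : X => ℝ) ∞ →ₗ[ℝ] ℝ) : Prop where
  nonneg : ∀ f : lp (fun _ : X => ℝ) ∞, (∀ x, 0 ≤ f x) → 0 ≤ m f
  one : m 1 = 1

/-- The composition with `φ`, as a linear map `ℓ^∞(Y) → ℓ^∞(X)`. -/
def pullback {X Y : Type*} (φ : X → Y) :
    lp (fun _ : Y => ℝ) ∞ →ₗ[ℝ] lp (fun _ : X => ℝ) ∞ where
  toFun f := ⟨fun x => f (φ x), memℓp_infty ⟨‖f‖, by
    rintro _ ⟨x, rfl⟩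
    exact lp.norm_apply_le_norm ENNReal.top_ne_zero f (φ x)⟩⟩
  map_add' _ _ := rfl
  map_smul' _ _ := rfl

@[simp] theorem pullback_apply {X Y : Type*} (φ : X → Y) (f : lp (fun _ : Y => ℝ) ∞) (x : X) :
    pullback φ f x = f (φ x) := rfl

theorem pullback_one {X Y : Type*} (φ : X → Y) : pullback φ 1 = 1 := rfl

theorem norm_pullback_le {X Y : Type*} (φ : X → Y) (f : lp (fun _ : Y => ℝ) ∞) :
    ‖pullback φ f‖ ≤ ‖f‖ :=
  lp.norm_le_of_forall_le (norm_nonneg f) fun x =>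
    lp.norm_apply_le_norm ENNReal.top_ne_zero f (φ x)

namespace IsMean

variable {X Y : Type*} {m : lp (fun _ : X => ℝ) ∞ →ₗ[ℝ] ℝ}

theorem abs_apply_le (hm : IsMean m) (f : lp (fun _ : X => ℝ) ∞) : |m f| ≤ ‖f‖ := by
  have hf (x : X) : |f x| ≤ ‖f‖ := lp.norm_apply_le_norm ENNReal.top_ne_zero f x
  have h1 := hm.nonneg (‖f‖ • 1 - f) fun x => by
    change 0 ≤ ‖f‖ * 1 - f x
    linarith [(abs_le.1 (hf x)).2]
  have h2 := hm.nonneg (‖f‖ • 1 + f) fun x => by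
    change 0 ≤ ‖f‖ * 1 + f x
    linarith [(abs_le.1 (hf x)).1]
  simp only [map_sub, map_add, map_smul, hm.one, smul_eq_mul, mul_one] at h1 h2
  exact abs_le.2 ⟨by linarith, by linarith⟩

theorem comp_pullback (hm : IsMean m) (φ : X → Y) : IsMean (m ∘ₗ pullback φ) where
  nonneg f hf := hm.nonneg _ fun x => hf (φ x)
  one := by simp [pullback_one, hm.one]

/-- The evaluation at a point is a mean. -/
theorem eval (x : X) : IsMean (lp.evalₗ (𝕜 := ℝ) (fun _ : X => ℝ) ∞ x) where
  nonneg _ hf := hf x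
  one := rfl

/-- The average of finitely many means is a mean. -/
theorem average {ι : Type*} {s : Finset ι} (hs : s.Nonempty)
    {M : ι → lp (fun _ : X => ℝ) ∞ →ₗ[ℝ] ℝ} (hM : ∀ i, IsMean (M i)) :
    IsMean ((s.card : ℝ)⁻¹ • ∑ i ∈ s, M i) where
  nonneg f hf := by
    simp only [LinearMap.smul_apply, LinearMap.sum_apply, smul_eq_mul]
    exact mul_nonneg (by positivity) (Finset.sum_nonneg fun i _ => (hM i).nonneg f hf)
  one := by
    have : (s.card : ℝ) ≠ 0 := by exact_mod_cast hs.card_pos.ne'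
    simp [(hM _).one, this]

/-- Weak-* compactness of the set of means: a net of means has a limit point, and the limit
inherits every relation `m f' = m f` that holds asymptotically along the net. -/
theorem exists_limit {ι : Type*} (l : Filter ι) [l.NeBot]
    {M : ι → lp (fun _ : X => ℝ) ∞ →ₗ[ℝ] ℝ} (hM : ∀ i, IsMean (M i)) :
    ∃ m : lp (fun _ : X => ℝ) ∞ →ₗ[ℝ] ℝ, IsMean m ∧
      ∀ f f', Tendsto (fun i => M i f' - M i f) l (𝓝 0) → m f' = m f := by
  have hle : (Ultrafilter.of l : Filter ι) ≤ l := Ultrafilter.of_le l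
  have hlim (f : lp (fun _ : X => ℝ) ∞) :
      ∃ a, Tendsto (fun i => M i f) (Ultrafilter.of l : Filter ι) (𝓝 a) := by
    obtain ⟨a, -, ha⟩ := (isCompact_Icc (a := -‖f‖) (b := ‖f‖)).ultrafilter_le_nhds
      ((Ultrafilter.of l).map fun i => M i f) (by
        rw [Filter.le_principal_iff, Ultrafilter.coe_map, Filter.mem_map]
        exact Filter.univ_mem' fun i => abs_le.1 ((hM i).abs_apply_le f))
    exact ⟨a, ha⟩
  choose m hm using hlim
  refine ⟨⟨⟨m, fun f g => ?_⟩, fun c f => ?_⟩, ⟨fun f hf => ?_, ?_⟩, fun f f' h => ?_⟩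
  · refine tendsto_nhds_unique (hm (f + g)) ?_
    simpa using (hm f).add (hm g)
  · refine tendsto_nhds_unique (hm (c • f)) ?_
    simpa using (hm f).const_mul c
  · exact ge_of_tendsto (hm f) (Eventually.of_forall fun i => (hM i).nonneg f hf)
  · refine tendsto_nhds_unique (hm 1) ?_
    simp [(hM _).one]
  · exact sub_eq_zero.1 (tendsto_nhds_unique ((hm f').sub (hm f)) (h.mono_left hle))

end IsMean

/-! ### Permanence properties of amenability -/

section Amenable

variable {G : Type*} [Group G]

/-- There is a mean on `G` which is invariant under left translation by the elements of `A`. -/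
def HasInvariantMean (A : Set G) : Prop :=
  ∃ m : lp (fun _ : G => ℝ) ∞ →ₗ[ℝ] ℝ, IsMean m ∧
    ∀ g ∈ A, ∀ f, m (pullback (g * ·) f) = m f

theorem HasInvariantMean.mono {A B : Set G} (h : HasInvariantMean B) (hAB : A ⊆ B) :
    HasInvariantMean A := by
  obtain ⟨m, hm, h⟩ := h
  exact ⟨m, hm, fun g hg => h g (hAB hg)⟩

theorem isAmenable_iff : IsAmenable G ↔ HasInvariantMean (Set.univ : Set G) := by
  constructor
  · rintro ⟨m, h0, h1, h2⟩
    exact ⟨m, ⟨h0, h1⟩, fun g _ f => h2 g f _ fun _ => rfl⟩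
  · rintro ⟨m, ⟨h0, h1⟩, h2⟩
    refine ⟨m, h0, h1, fun g f f' h => ?_⟩
    have : f' = pullback (g * ·) f := lp.ext (funext h)
    rw [this, h2 g trivial]

theorem HasInvariantMean.closure {A : Set G} (h : HasInvariantMean A) :
    HasInvariantMean (Subgroup.closure A : Set G) := by
  obtain ⟨m, hm, h⟩ := h
  refine ⟨m, hm, fun g hg => ?_⟩
  induction hg using Subgroup.closure_induction with
  | mem x hx => exact h x hx
  | one => intro f; congr 1; exact lp.ext (funext fun x => by simp)
  | mul x y _ _ hx hy =>
    intro f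
    rw [← hx f, ← hy (pullback (x * ·) f)]
    congr 1
    exact lp.ext (funext fun z => by simp [mul_assoc])
  | inv x _ hx =>
    intro f
    rw [← hx (pullback (x⁻¹ * ·) f)]
    congr 1
    exact lp.ext (funext fun z => by simp)

theorem IsAmenable.hasInvariantMean {H : Subgroup G} (h : IsAmenable H) :
    HasInvariantMean (H : Set G) := by
  obtain ⟨m, hm, h⟩ := isAmenable_iff.1 h
  refine ⟨m ∘ₗ pullback Subtype.val, hm.comp_pullback _, fun g hg f => ?_⟩
  exact h ⟨g, hg⟩ trivial (pullback Subtype.val f)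

/-- Amenability is a local property. -/
theorem IsAmenable.of_finset (h : ∀ A : Finset G, HasInvariantMean (A : Set G)) :
    IsAmenable G := by
  choose M hM hinv using h
  obtain ⟨m, hm, hlim⟩ := IsMean.exists_limit atTop hM
  refine isAmenable_iff.2 ⟨m, hm, fun g _ f => hlim _ _ ?_⟩
  refine tendsto_const_nhds.congr' ?_
  filter_upwards [eventually_ge_atTop ({g} : Finset G)] with A hA
  rw [hinv A g (by simpa using hA), sub_self]

theorem IsAmenable.of_surjective {Q : Type*} [Group Q] (φ : G →* Q)
    (hφ : Function.Surjective φ) (h : IsAmenable G) : IsAmenable Q := by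
  obtain ⟨m, hm, h⟩ := isAmenable_iff.1 h
  refine isAmenable_iff.2 ⟨m ∘ₗ pullback φ, hm.comp_pullback _, fun q _ f => ?_⟩
  obtain ⟨g, rfl⟩ := hφ q
  rw [LinearMap.comp_apply, LinearMap.comp_apply, ← h g trivial (pullback φ f)]
  congr 1
  exact lp.ext (funext fun x => by simp)

/-- An extension of an amenable group by an amenable group is amenable: average over the cosets of
`K` first, and then over the quotient. -/
theorem IsAmenable.extension (K : Subgroup G) [K.Normal] (hK : IsAmenable K)
    (hQ : IsAmenable (G ⧸ K)) : IsAmenable G := by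
  obtain ⟨k, hk, hkinv⟩ := isAmenable_iff.1 hK
  obtain ⟨q, hq, hqinv⟩ := isAmenable_iff.1 hQ
  let coset (g : G) : K → G := fun x => g * x
  -- The average over the coset `gK` does not depend on the representative `g`.
  have hcoset (f : lp (fun _ : G => ℝ) ∞) (g g' : G) (h : (g : G ⧸ K) = g') :
      k (pullback (coset g) f) = k (pullback (coset g') f) := by
    rw [← hkinv ⟨g⁻¹ * g', QuotientGroup.eq.1 h⟩ trivial (pullback (coset g) f)]
    congr 1
    exact lp.ext (funext fun x => by simp [coset, mul_assoc])
  let avg : lp (fun _ : G => ℝ) ∞ →ₗ[ℝ] lp (fun _ : G ⧸ K => ℝ) ∞ :=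
    { toFun := fun f => ⟨fun x => k (pullback (coset x.out) f), memℓp_infty ⟨‖f‖, by
        rintro _ ⟨x, rfl⟩
        exact (hk.abs_apply_le _).trans (norm_pullback_le _ f)⟩⟩
      map_add' := fun f g => lp.ext (funext fun x => by
        simp only [map_add]
        rfl)
      map_smul' := fun c f => lp.ext (funext fun x => by
        simp only [map_smul]
        rfl) }
  have havg (f : lp (fun _ : G => ℝ) ∞) (x : G ⧸ K) : avg f x = k (pullback (coset x.out) f) := rfl
  refine isAmenable_iff.2 ⟨q ∘ₗ avg, ⟨fun f hf => ?_, ?_⟩, fun g _ f => ?_⟩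
  · exact hq.nonneg _ fun x => hk.nonneg _ fun y => hf _
  · have : avg 1 = 1 := lp.ext (funext fun x => by simp [havg, pullback_one, hk.one])
    simp [this, hq.one]
  · rw [LinearMap.comp_apply, LinearMap.comp_apply, ← hqinv (g : G ⧸ K) trivial (avg f)]
    congr 1
    refine lp.ext (funext fun x => ?_)
    rw [pullback_apply, havg, havg, hcoset f _ (g * x.out) (by simp)]
    congr 1
    exact lp.ext (funext fun y => by simp [coset, mul_assoc])

/-- The join of two amenable subgroups, one of which is normal, is amenable. -/
theorem IsAmenable.sup {H N : Subgroup G} [N.Normal] (hH : IsAmenable H) (hN : IsAmenable N) :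
    IsAmenable ↥(H ⊔ N) := by
  refine IsAmenable.extension (N.subgroupOf (H ⊔ N)) ?_ ?_
  · let e := Subgroup.subgroupOfEquivOfLe (le_sup_right : N ≤ H ⊔ N)
    exact hN.of_surjective e.symm.toMonoidHom e.symm.surjective
  · let e := QuotientGroup.quotientInfEquivProdNormalQuotient H N
    exact (hH.of_surjective (QuotientGroup.mk' (N.subgroupOf H))
      (QuotientGroup.mk'_surjective _)).of_surjective e.toMonoidHom e.surjective

/-- Abelian groups are amenable. -/
theorem IsAmenable.of_comm (hcomm : ∀ a b : G, a * b = b * a) : IsAmenable G := by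
  classical
  refine IsAmenable.of_finset fun A => ?_
  induction A using Finset.induction_on with
  | empty => exact ⟨_, IsMean.eval (1 : G), by simp⟩
  | insert t A _ ih =>
    obtain ⟨m, hm, hinv⟩ := ih
    -- Average the given mean over the translates by `1, t, …, tⁿ`.
    let T (i : ℕ) := m ∘ₗ pullback ((t ^ i : G) * ·)
    let M (n : ℕ) := ((Finset.range (n + 1)).card : ℝ)⁻¹ • ∑ i ∈ Finset.range (n + 1), T i
    have hMapply (n : ℕ) (f : lp (fun _ : G => ℝ) ∞) :
        M n f = ((n : ℝ) + 1)⁻¹ * ∑ i ∈ Finset.range (n + 1), T i f := by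
      simp [M]
    have hT (i : ℕ) : IsMean (T i) := hm.comp_pullback _
    obtain ⟨m', hm', hlim⟩ := IsMean.exists_limit atTop
      (fun n => IsMean.average (s := Finset.range (n + 1)) (by simp) hT)
    refine ⟨m', hm', fun g hg f => hlim _ _ ?_⟩
    change Tendsto (fun n => M n (pullback (g * ·) f) - M n f) atTop (𝓝 0)
    rcases Finset.mem_insert.1 hg with rfl | hg
    · -- The sum telescopes.
      have hshift (i : ℕ) : T i (pullback (g * ·) f) = T (i + 1) f := by
        simp only [T, LinearMap.comp_apply]
        congr 1
        exact lp.ext (funext fun x => by simp [pow_succ', mul_assoc])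
      refine squeeze_zero_norm (a := fun n : ℕ => 2 * ‖f‖ * (1 / ((n : ℝ) + 1))) (fun n => ?_) ?_
      · rw [hMapply, hMapply, ← mul_sub, ← Finset.sum_sub_distrib]
        simp_rw [hshift]
        rw [Finset.sum_range_sub (fun i => T i f), norm_mul, norm_inv, Real.norm_eq_abs,
          abs_of_pos (by positivity : (0 : ℝ) < n + 1), mul_comm, one_div]
        gcongr
        calc ‖T (n + 1) f - T 0 f‖ ≤ ‖T (n + 1) f‖ + ‖T 0 f‖ := norm_sub_le _ _
          _ ≤ ‖f‖ + ‖f‖ := add_le_add ((hT _).abs_apply_le f) ((hT _).abs_apply_le f)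
          _ = 2 * ‖f‖ := by ring
      · simpa using tendsto_one_div_add_atTop_nhds_zero_nat.const_mul (2 * ‖f‖)
    · have hTg (i : ℕ) : T i (pullback (g * ·) f) = T i f := by
        simp only [T, LinearMap.comp_apply]
        rw [← hinv g hg (pullback ((t ^ i : G) * ·) f)]
        congr 1
        refine lp.ext (funext fun x => ?_)
        simp only [pullback_apply]
        rw [← mul_assoc, ← mul_assoc, hcomm g]
      simp [hMapply, hTg]

/-- Along a sequence of finite sets of subexponentially growing size, the ratio of consecutive
sizes is at some point arbitrarily close to `1`. -/
theorem exists_card_succ_le {Q : Type*} {W : ℕ → Finset Q} (h0 : (W 0).Nonempty)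
    (hgrow : GrowsSubexponentially fun n => ((W n).card : ℝ)) {ε : ℝ} (hε : 0 < ε) :
    ∃ n, ((W (n + 1)).card : ℝ) ≤ (1 + ε) * (W n).card := by
  by_contra! h
  have hpow (n : ℕ) : (1 + ε) ^ n ≤ (W n).card := by
    induction n with
    | zero => simpa using h0.card_pos
    | succ n ih =>
      rw [pow_succ']
      exact (mul_le_mul_of_nonneg_left ih (by positivity)).trans (h n).le
  obtain ⟨C, hC⟩ := hgrow (1 + ε / 2) (by linarith)
  have hr : 1 < (1 + ε) / (1 + ε / 2) := by
    rw [one_lt_div (by positivity)]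
    linarith
  obtain ⟨n, hn⟩ := pow_unbounded_of_one_lt C hr
  rw [div_pow, lt_div_iff₀ (by positivity)] at hn
  exact absurd ((hpow n).trans (hC n)) (not_le.2 hn)

/-- A group which is exhausted, from a finite generating set `T`, by finite sets of subexponentially
growing size is amenable: some of these sets are almost invariant under `T`. -/
theorem IsAmenable.of_subexponential {T : Set G} (hT : Subgroup.closure T = ⊤)
    {W : ℕ → Finset G} (h0 : (W 0).Nonempty) (hmono : ∀ n, W n ⊆ W (n + 1))
    (hmul : ∀ t ∈ T, ∀ n, ∀ w ∈ W n, t * w ∈ W (n + 1))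
    (hgrow : GrowsSubexponentially fun n => ((W n).card : ℝ)) : IsAmenable G := by
  classical
  have hne (n : ℕ) : (W n).Nonempty := by
    induction n with
    | zero => exact h0
    | succ n ih => exact ih.mono (hmono n)
  choose n hn using fun k : ℕ =>
    exists_card_succ_le h0 hgrow (by positivity : (0 : ℝ) < 1 / ((k : ℝ) + 1))
  obtain ⟨m, hm, hlim⟩ := IsMean.exists_limit atTop
    (fun k => IsMean.average (hne (n k)) (IsMean.eval (X := G)))
  rw [isAmenable_iff, ← Subgroup.coe_top, ← hT]
  refine HasInvariantMean.closure ⟨m, hm, fun t ht f => hlim _ _ ?_⟩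
  refine squeeze_zero_norm (a := fun k : ℕ => 2 * ‖f‖ * (1 / ((k : ℝ) + 1))) (fun k => ?_) ?_
  · have hf (x : G) : ‖f x‖ ≤ ‖f‖ := lp.norm_apply_le_norm ENNReal.top_ne_zero f x
    have hsum (B : Finset G) (hB : B ⊆ W (n k + 1)) (hcard : B.card = (W (n k)).card) :
        ‖∑ x ∈ W (n k + 1), f x - ∑ x ∈ B, f x‖ ≤
          (W (n k)).card * (1 / ((k : ℝ) + 1)) * ‖f‖ := by
      rw [← Finset.sum_sdiff hB, add_sub_cancel_right]
      refine (norm_sum_le_of_le _ fun x _ => hf x).trans ?_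
      rw [Finset.sum_const, nsmul_eq_mul, Finset.card_sdiff_of_subset hB,
        Nat.cast_sub (Finset.card_le_card hB), hcard]
      gcongr
      linarith [hn k]
    have h1 := hsum (W (n k)) (hmono _) rfl
    have h2 := hsum ((W (n k)).image (t * ·))
      (Finset.image_subset_iff.2 fun w hw => hmul t ht _ w hw)
      (Finset.card_image_of_injective _ (mul_right_injective t))
    rw [Finset.sum_image fun x _ y _ h => mul_right_injective t h] at h2
    have hpos : (0 : ℝ) < (W (n k)).card := by exact_mod_cast (hne (n k)).card_pos
    have h3 : ‖∑ x ∈ W (n k), f (t * x) - ∑ x ∈ W (n k), f x‖ ≤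
        (W (n k)).card * (2 * ‖f‖ * (1 / ((k : ℝ) + 1))) := by
      calc _ = ‖(∑ x ∈ W (n k + 1), f x - ∑ x ∈ W (n k), f x) -
            (∑ x ∈ W (n k + 1), f x - ∑ x ∈ W (n k), f (t * x))‖ := by congr 1; ring
        _ ≤ _ := (norm_sub_le _ _).trans (add_le_add h1 h2)
        _ = _ := by ring
    simp only [LinearMap.smul_apply, LinearMap.sum_apply, smul_eq_mul, ← mul_sub]
    rw [norm_mul, norm_inv, Real.norm_natCast, inv_mul_le_iff₀ hpos]
    exact h3
  · simpa using tendsto_one_div_add_atTop_nhds_zero_nat.const_mul (2 * ‖f‖)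

end Amenable


/-! ### Growth types -/

theorem GrowsPolynomially.mono {f g : ℕ → ℝ} (hg : GrowsPolynomially g) (h : ∀ n, f n ≤ g n) :
    GrowsPolynomially f := by
  obtain ⟨p, hp⟩ := hg
  exact ⟨p, fun n => (h n).trans (hp n)⟩

theorem GrowsSubexponentially.mono {f g : ℕ → ℝ} (hg : GrowsSubexponentially g)
    (h : ∀ n, f n ≤ g n) : GrowsSubexponentially f := by
  intro b hb
  obtain ⟨C, hC⟩ := hg b hb
  exact ⟨C, fun n => (h n).trans (hC n)⟩

theorem GrowsPolynomially.pow {f : ℕ → ℝ} (hf : GrowsPolynomially f) (h0 : ∀ n, 0 ≤ f n) (k : ℕ) :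
    GrowsPolynomially fun n => f n ^ k := by
  obtain ⟨p, hp⟩ := hf
  exact ⟨p ^ k, fun n => by
    rw [Polynomial.eval_pow]
    exact pow_le_pow_left₀ (h0 n) (hp n) k⟩

theorem GrowsSubexponentially.comp_linear_pow {f : ℕ → ℝ} (hf : GrowsSubexponentially f)
    (h0 : ∀ n, 0 ≤ f n) (a c k : ℕ) : GrowsSubexponentially fun n => f (a * n + c) ^ k := by
  intro b hb
  -- A base `β > 1` with `β ^ (a * k) ≤ b`.
  obtain ⟨β, hβ, hβb⟩ : ∃ β : ℝ, 1 < β ∧ β ^ (a * k + 1) = b :=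
    ⟨b ^ (((a * k + 1 : ℕ) : ℝ)⁻¹), Real.one_lt_rpow hb (by positivity),
      Real.rpow_inv_natCast_pow (by linarith) (by simp)⟩
  obtain ⟨C, hC⟩ := hf β hβ
  have hC0 : 0 ≤ C := by simpa using (h0 0).trans (hC 0)
  refine ⟨C ^ k * β ^ (c * k), fun n => ?_⟩
  calc f (a * n + c) ^ k ≤ (C * β ^ (a * n + c)) ^ k := pow_le_pow_left₀ (h0 _) (hC _) k
    _ = C ^ k * β ^ (c * k) * (β ^ (a * k)) ^ n := by ring
    _ ≤ C ^ k * β ^ (c * k) * b ^ n := by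
      rw [← hβb]
      gcongr
      · exact hβ.le
      · exact Nat.le_succ _

theorem GrowsPolynomially.growsSubexponentially {f : ℕ → ℝ} (hf : GrowsPolynomially f) :
    GrowsSubexponentially f := by
  obtain ⟨p, hp⟩ := hf
  intro b hb
  have hlim : Tendsto (fun n : ℕ => p.eval (n : ℝ) / b ^ n) atTop (𝓝 0) := by
    simp_rw [Polynomial.eval_eq_sum, Polynomial.sum, Finset.sum_div]
    rw [← Finset.sum_const_zero (s := p.support)]
    refine tendsto_finsetSum _ fun i _ => ?_
    simpa [mul_div_assoc] using
      (tendsto_pow_const_div_const_pow_of_one_lt i hb).const_mul (p.coeff i)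
  obtain ⟨C, hC⟩ := hlim.bddAbove_range
  refine ⟨C, fun n => (hp n).trans ?_⟩
  rw [← div_le_iff₀ (by positivity)]
  exact hC ⟨n, rfl⟩

/-! ### Balls for the word length -/

section Ball

variable {G : Type*} [Group G] {S : Finset G}

theorem ball_finite (S : Finset G) (n : ℕ) : (ball S n).Finite := by
  refine ((List.finite_length_le S n).image fun l => (l.map Subtype.val).prod).subset ?_
  rintro _ ⟨l, hl, hn, rfl⟩
  lift l to List S using hl
  exact ⟨l, by simpa using hn, rfl⟩

theorem one_mem_ball (S : Finset G) (n : ℕ) : (1 : G) ∈ ball S n := ⟨[], by simp⟩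

theorem ball_mono {m n : ℕ} (h : m ≤ n) : ball S m ⊆ ball S n := by
  rintro _ ⟨l, hl, hn, rfl⟩
  exact ⟨l, hl, hn.trans h, rfl⟩

theorem mul_mem_ball {m n : ℕ} {x y : G} (hx : x ∈ ball S m) (hy : y ∈ ball S n) :
    x * y ∈ ball S (m + n) := by
  obtain ⟨l, hl, hm, rfl⟩ := hx
  obtain ⟨l', hl', hn, rfl⟩ := hy
  refine ⟨l ++ l', fun s hs => ?_, ?_, List.prod_append⟩
  · exact (List.mem_append.1 hs).elim (hl s) (hl' s)
  · rw [List.length_append]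
    exact add_le_add hm hn

theorem mem_ball_one {s : G} (hs : s ∈ S) : s ∈ ball S 1 := ⟨[s], by simpa using hs, by simp⟩

theorem inv_mem_ball (hsymm : ∀ s ∈ S, s⁻¹ ∈ S) {n : ℕ} {x : G} (hx : x ∈ ball S n) :
    x⁻¹ ∈ ball S n := by
  obtain ⟨l, hl, hn, rfl⟩ := hx
  refine ⟨(l.map (·⁻¹)).reverse, fun s hs => ?_, by simpa using hn, (List.prod_inv_reverse l).symm⟩
  obtain ⟨t, ht, rfl⟩ := List.mem_map.1 (List.mem_reverse.1 hs)
  exact hsymm t (hl t ht)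

theorem exists_mem_ball (hsymm : ∀ s ∈ S, s⁻¹ ∈ S) (hgen : Subgroup.closure (S : Set G) = ⊤)
    (x : G) : ∃ n, x ∈ ball S n := by
  have hx : x ∈ Subgroup.closure (S : Set G) := hgen ▸ Subgroup.mem_top x
  induction hx using Subgroup.closure_induction with
  | mem x hx => exact ⟨1, mem_ball_one hx⟩
  | one => exact ⟨0, one_mem_ball S 0⟩
  | mul x y _ _ hx hy =>
    obtain ⟨m, hm⟩ := hx
    obtain ⟨n, hn⟩ := hy
    exact ⟨m + n, mul_mem_ball hm hn⟩
  | inv x _ hx => exact hx.imp fun n => inv_mem_ball hsymm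

theorem exists_subset_ball (hsymm : ∀ s ∈ S, s⁻¹ ∈ S)
    (hgen : Subgroup.closure (S : Set G) = ⊤) (F : Finset G) : ∃ n, (F : Set G) ⊆ ball S n := by
  choose r hr using exists_mem_ball hsymm hgen
  exact ⟨F.sup r, fun x hx => ball_mono (Finset.le_sup hx) (hr x)⟩

theorem growth_nonneg (S : Finset G) (A : Set G) (n : ℕ) : 0 ≤ growth S A n := Nat.cast_nonneg _

/-- Lengths of lifts grow linearly: if every element of `T` has a lift of word length at most `L`
with respect to `S`, then every product of at most `n` elements of `T` has one of length at most
`n * L`. -/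
theorem exists_lift_mem_ball {H : Subgroup G} {Q : Type*} [Group Q] (π : H →* Q) {T : Finset Q}
    {L : ℕ} (hT : ∀ t ∈ T, ∃ h : H, π h = t ∧ (h : G) ∈ ball S L) {n : ℕ} {q : Q}
    (hq : q ∈ ball T n) : ∃ h : H, π h = q ∧ (h : G) ∈ ball S (n * L) := by
  obtain ⟨l, hl, hn, rfl⟩ := hq
  suffices h : ∃ h : H, π h = l.prod ∧ (h : G) ∈ ball S (l.length * L) by
    obtain ⟨h, h1, h2⟩ := h
    exact ⟨h, h1, ball_mono (Nat.mul_le_mul_right L hn) h2⟩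
  clear hn
  induction l with
  | nil => exact ⟨1, by simp, one_mem_ball S _⟩
  | cons t l ih =>
    obtain ⟨h, h1, h2⟩ := ih fun s hs => hl s (List.mem_cons_of_mem t hs)
    obtain ⟨k, k1, k2⟩ := hT t (hl t List.mem_cons_self)
    refine ⟨k * h, by simp [h1, k1], ?_⟩
    rw [List.length_cons, Nat.succ_mul, add_comm]
    exact mul_mem_ball k2 h2

end Ball

/-! ### Elements with subexponentially growing conjugacy class -/

section Conjugacy

variable {Γ : Type*} [Group Γ] {S : Finset Γ}

/-- Finitely many conjugates of an element `g` of `SEC S` generate an amenable group `H`. An element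
of `H` is determined modulo the centre of `H` by the conjugates of the generators by it, and these
are conjugates of `g`. Hence the quotient of `H` by its centre has subexponential growth. -/
theorem isAmenable_closure_of_mem_SEC (hsymm : ∀ s ∈ S, s⁻¹ ∈ S)
    (hgen : Subgroup.closure (S : Set Γ) = ⊤) {g : Γ} (hg : g ∈ SEC S) {F : Finset Γ}
    (hF : (F : Set Γ) ⊆ conjugatesOf g) : IsAmenable (Subgroup.closure (F : Set Γ)) := by
  classical
  obtain ⟨L, hL⟩ := exists_subset_ball hsymm hgen F
  set H := Subgroup.closure (F : Set Γ)
  refine IsAmenable.extension (Subgroup.center H)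
    (IsAmenable.of_comm fun a b => Subtype.ext (Subgroup.mem_center_iff.1 b.2 a)) ?_
  let π := QuotientGroup.mk' (Subgroup.center H)
  let gen (c : F) : H := ⟨c, Subgroup.subset_closure c.2⟩
  let T : Finset (H ⧸ Subgroup.center H) := Finset.univ.image fun c => π (gen c)
  have hT : Subgroup.closure (T : Set (H ⧸ Subgroup.center H)) = ⊤ := by
    have hcl : Subgroup.closure (((↑) : H → Γ) ⁻¹' F) = ⊤ :=
      Subgroup.closure_closure_coe_preimage
    have himg : (T : Set (H ⧸ Subgroup.center H)) = π '' (((↑) : H → Γ) ⁻¹' F) := by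
      ext q
      simp only [T, Finset.coe_image, Finset.coe_univ, Set.image_univ, Set.mem_range, Set.mem_image,
        Set.mem_preimage]
      constructor
      · rintro ⟨c, rfl⟩
        exact ⟨gen c, c.2, rfl⟩
      · rintro ⟨h, hh, rfl⟩
        exact ⟨⟨h, hh⟩, rfl⟩
    rw [himg, ← MonoidHom.map_closure, hcl, ← MonoidHom.range_eq_map,
      MonoidHom.range_eq_top.2 (QuotientGroup.mk'_surjective _)]
  have hlift (n : ℕ) (q : H ⧸ Subgroup.center H) (hq : q ∈ ball T n) :
      ∃ h : H, π h = q ∧ (h : Γ) ∈ ball S (n * L) := by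
    refine exists_lift_mem_ball π (fun t ht => ?_) hq
    obtain ⟨c, -, rfl⟩ := Finset.mem_image.1 ht
    exact ⟨gen c, rfl, hL c.2⟩
  have hcard (n : ℕ) : ((ball_finite T n).toFinset.card : ℝ) ≤
      growth S (conjugatesOf g) (2 * L * n + L) ^ F.card := by
    choose! h hπ hh using hlift n
    have hfin : (conjugatesOf g ∩ ball S (2 * L * n + L)).Finite :=
      (ball_finite S _).inter_of_right _
    have hle : (ball_finite T n).toFinset.card ≤
        (Fintype.piFinset fun _ : F => hfin.toFinset).card := by
      refine Finset.card_le_card_of_injOn (fun q c => (h q : Γ) * c * (h q : Γ)⁻¹) ?_ ?_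
      · intro q hq
        have hq := hh q (by simpa using hq)
        refine Finset.mem_coe.2 (Fintype.mem_piFinset.2 fun c => hfin.mem_toFinset.2 ⟨?_, ?_⟩)
        · exact IsConj.trans (hF c.2) (isConj_iff.2 ⟨h q, rfl⟩)
        · have := mul_mem_ball (mul_mem_ball hq (hL c.2)) (inv_mem_ball hsymm hq)
          convert this using 2
          ring
      · intro q hq q' hq' heq
        rw [← hπ q (by simpa using hq), ← hπ q' (by simpa using hq')]
        refine QuotientGroup.eq.2 (Subgroup.mem_center_iff.2 fun x => Subtype.ext ?_)
        have hle : H ≤ Subgroup.centralizer {(h q : Γ)⁻¹ * (h q' : Γ)} := by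
          refine (Subgroup.closure_le _).2 fun c hc => ?_
          have hc : (h q : Γ) * c * (h q : Γ)⁻¹ = h q' * c * (h q' : Γ)⁻¹ :=
            congrFun heq ⟨c, hc⟩
          refine Subgroup.mem_centralizer_singleton_iff.2 ?_
          rw [mul_inv_eq_iff_eq_mul] at hc
          calc c * ((h q : Γ)⁻¹ * h q') = (h q : Γ)⁻¹ * (h q * c) * (h q : Γ)⁻¹ * h q' := by group
            _ = (h q : Γ)⁻¹ * h q' * c := by rw [hc]; group
        exact Subgroup.mem_centralizer_singleton_iff.1 (hle x.2)
    rw [Fintype.card_piFinset, Finset.prod_const, Finset.card_univ, Fintype.card_coe,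
      ← Set.ncard_eq_toFinset_card _ hfin] at hle
    rw [growth]
    exact_mod_cast hle
  refine IsAmenable.of_subexponential hT (W := fun n => (ball_finite T n).toFinset)
    ⟨1, by simpa using one_mem_ball T 0⟩ (fun n => ?_) (fun t ht n w hw => ?_)
    ((hg.comp_linear_pow (growth_nonneg S _) _ _ _).mono hcard)
  · simpa using ball_mono n.le_succ
  · rw [Set.Finite.mem_toFinset] at hw ⊢
    rw [add_comm]
    exact mul_mem_ball (mem_ball_one ht) hw

/-- A group is amenable if it is generated by a set whose finite subsets generate amenable
groups. -/
theorem isAmenable_closure {A : Set Γ}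
    (h : ∀ F : Finset Γ, (F : Set Γ) ⊆ A → IsAmenable (Subgroup.closure (F : Set Γ))) :
    IsAmenable (Subgroup.closure A) := by
  classical
  have hfin (x : Γ) (hx : x ∈ Subgroup.closure A) :
      ∃ F : Finset Γ, (F : Set Γ) ⊆ A ∧ x ∈ Subgroup.closure (F : Set Γ) := by
    induction hx using Subgroup.closure_induction with
    | mem x hx => exact ⟨{x}, by simpa using hx, Subgroup.subset_closure (by simp)⟩
    | one => exact ⟨∅, by simp, one_mem _⟩
    | mul x y _ _ hx hy =>
      obtain ⟨F, hF, hx⟩ := hx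
      obtain ⟨F', hF', hy⟩ := hy
      refine ⟨F ∪ F', by simp [hF, hF'], mul_mem ?_ ?_⟩
      · exact Subgroup.closure_mono (by simp) hx
      · exact Subgroup.closure_mono (by simp) hy
    | inv x _ hx =>
      obtain ⟨F, hF, hx⟩ := hx
      exact ⟨F, hF, inv_mem hx⟩
  choose! F hF hx using hfin
  refine IsAmenable.of_finset fun B => ?_
  let E : Finset Γ := B.biUnion fun x => F x
  have hE : (E : Set Γ) ⊆ A := by
    simpa [E] using fun x hx _ => hF x hx
  have hle : Subgroup.closure (E : Set Γ) ≤ Subgroup.closure A := Subgroup.closure_mono hE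
  let e := Subgroup.subgroupOfEquivOfLe hle
  refine ((h E hE).of_surjective e.symm.toMonoidHom e.symm.surjective).hasInvariantMean.mono ?_
  intro x hxB
  refine Subgroup.mem_subgroupOf.2 (Subgroup.closure_mono ?_ (hx x x.2))
  exact_mod_cast Finset.subset_biUnion_of_mem (fun x : Subgroup.closure A => F x) hxB

theorem SEC_subset_amenableRadical (hsymm : ∀ s ∈ S, s⁻¹ ∈ S)
    (hgen : Subgroup.closure (S : Set Γ) = ⊤) : SEC S ⊆ (amenableRadical Γ : Set Γ) := by
  intro g hg
  have hN : IsAmenable (Subgroup.normalClosure {g}) := by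
    refine isAmenable_closure fun F hF => isAmenable_closure_of_mem_SEC hsymm hgen hg ?_
    simpa [Group.conjugatesOfSet] using hF
  have hle : Subgroup.normalClosure {g} ≤ amenableRadical Γ :=
    le_sSup ⟨Subgroup.normalClosure_normal, hN⟩
  exact hle (Subgroup.subset_normalClosure rfl)

theorem PC_subset_SEC (S : Finset Γ) : PC S ⊆ SEC S :=
  fun _ hg => GrowsPolynomially.growsSubexponentially hg

end Conjugacy


/-! ### Amenability and the norm of the regular representation -/

section Kesten

variable {Γ : Type*} [Group Γ] {S : Finset Γ}

/-- An amenable subgroup `N` of `Γ` gives rise to probability measures on `Γ` which are almost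
invariant, in `ℓ¹`-norm, under translation by a given finite subset `A` of `N`. The proof separates
`0` from the convex hull of the tuples `(δ_{sx} - δ_x)_{s ∈ A}`, for `x ∈ N`: a separating
functional consists of bounded functions `φ_s` such that `∑ s, (φ_s (s x) - φ_s x)` is bounded
below by a positive constant, contrary to the existence of an invariant mean. -/
theorem IsAmenable.exists_almost_invariant {N : Subgroup Γ} (hN : IsAmenable N) {A : Finset Γ}
    (hA : (A : Set Γ) ⊆ N) {ε : ℝ} (hε : 0 < ε) :
    ∃ p : Γ → ℝ, (∀ x, 0 ≤ p x) ∧ HasSum p 1 ∧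
      ∀ s ∈ A, (Summable fun x => |p (s⁻¹ * x) - p x|) ∧ ∑' x, |p (s⁻¹ * x) - p x| ≤ ε := by
  classical
  obtain ⟨m, hm, hinv⟩ := isAmenable_iff.1 hN
  let δ (x : Γ) : lp (fun _ : Γ => ℝ) 1 := lp.single 1 x 1
  let v (x : N) : A → lp (fun _ : Γ => ℝ) 1 := fun s => δ (s * x) - δ x
  have h0 : (0 : A → lp (fun _ : Γ => ℝ) 1) ∈ closure (convexHull ℝ (Set.range v)) := by
    by_contra h0
    obtain ⟨Φ, u, hu, hΦ⟩ := geometric_hahn_banach_point_closed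
      (convex_convexHull ℝ (Set.range v)).closure isClosed_closure h0
    rw [map_zero] at hu
    let φ (s : A) : lp (fun _ : N => ℝ) ∞ :=
      ⟨fun x => Φ (Pi.single s (δ x)), memℓp_infty ⟨‖Φ‖, by
        rintro _ ⟨x, rfl⟩
        refine (Φ.le_opNorm _).trans ?_
        rw [Pi.norm_single, lp.norm_single one_pos, norm_one, mul_one]⟩⟩
    have hφ (s : A) (x : N) : φ s x = Φ (Pi.single s (δ x)) := rfl
    let t (s : A) : N := ⟨s, hA s.2⟩
    have key := hm.nonneg (∑ s, (pullback (t s * ·) (φ s) - φ s) - u • 1) fun x => by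
      have hx : u < Φ (v x) := hΦ _ (subset_closure (subset_convexHull ℝ _ ⟨x, rfl⟩))
      rw [← Finset.univ_sum_single (v x), map_sum] at hx
      rw [lp.coeFn_sub, Pi.sub_apply, lp.coeFn_sum, Finset.sum_apply]
      refine sub_nonneg.2 ?_
      calc (u • (1 : lp (fun _ : N => ℝ) ∞)) x = u := mul_one u
        _ ≤ ∑ s, Φ (Pi.single s (v x s)) := hx.le
        _ = _ := Finset.sum_congr rfl fun s _ => by
          rw [Pi.single_sub, map_sub]
          rfl
    simp only [map_sub, map_sum, map_smul, hm.one, hinv _ trivial, sub_self,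
      Finset.sum_const_zero, smul_eq_mul] at key
    linarith
  obtain ⟨w, hw, hdist⟩ := Metric.mem_closure_iff.1 h0 ε hε
  rw [convexHull_eq] at hw
  obtain ⟨ι, I, c, z, hc0, hc1, hz, rfl⟩ := hw
  rw [dist_zero_left, Finset.centerMass_eq_of_sum_1 _ _ hc1] at hdist
  choose! y hy using hz
  let P : lp (fun _ : Γ => ℝ) 1 := ∑ i ∈ I, c i • δ (y i)
  have hδ (x a : Γ) : δ x a = Pi.single (M := fun _ => ℝ) x 1 a :=
    lp.single_apply (E := fun _ => ℝ) 1 x 1 a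
  have hPapply (x : Γ) : P x = ∑ i ∈ I, c i * δ (y i) x := by
    simp only [P, lp.coeFn_sum, Finset.sum_apply, lp.coeFn_smul, Pi.smul_apply, smul_eq_mul]
  have hw (s : A) (x : Γ) : (∑ i ∈ I, c i • z i) s x = P ((s : Γ)⁻¹ * x) - P x := by
    rw [hPapply, hPapply, Finset.sum_apply, lp.coeFn_sum, Finset.sum_apply,
      ← Finset.sum_sub_distrib]
    refine Finset.sum_congr rfl fun i hi => ?_
    rw [← hy i hi, ← mul_sub]
    change c i * (δ (s * y i) x - δ (y i) x) = _
    rw [hδ, hδ, hδ]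
    simp only [Pi.single_apply, inv_mul_eq_iff_eq_mul]
  refine ⟨P, fun x => ?_, ?_, fun s hs => ?_⟩
  · rw [hPapply]
    refine Finset.sum_nonneg fun i hi => mul_nonneg (hc0 i hi) ?_
    rw [hδ, Pi.single_apply]
    split_ifs <;> simp
  · have hsum (a : Γ) : HasSum (fun x => δ a x) 1 := by
      simpa only [hδ] using hasSum_pi_single a (1 : ℝ)
    have : HasSum (fun x => ∑ i ∈ I, c i * δ (y i) x) (∑ i ∈ I, c i * 1) :=
      hasSum_sum fun i _ => (hsum (y i)).mul_left _
    simpa only [← hPapply, mul_one, hc1] using this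
  · have hnorm := lp.hasSum_norm (p := 1) (by simp) ((∑ i ∈ I, c i • z i) ⟨s, hs⟩)
    simp only [ENNReal.toReal_one, Real.rpow_one, hw ⟨s, hs⟩, Real.norm_eq_abs] at hnorm
    refine ⟨hnorm.summable, hnorm.tsum_eq.trans_le ?_⟩
    exact (norm_le_pi_norm _ _).trans hdist.le

theorem norm_sq_eq_tsum {X : Type*} (ξ : lp (fun _ : X => ℂ) 2) : ‖ξ‖ ^ 2 = ∑' x, ‖ξ x‖ ^ 2 := by
  have := lp.norm_rpow_eq_tsum (p := 2) (by simp) ξ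
  simpa using this

theorem sq_sqrt_sub_sqrt_le {a b : ℝ} (ha : 0 ≤ a) (hb : 0 ≤ b) : (√a - √b) ^ 2 ≤ |a - b| := by
  have h : |a - b| = |√a - √b| * (√a + √b) := by
    rw [← abs_of_nonneg (add_nonneg (Real.sqrt_nonneg a) (Real.sqrt_nonneg b)), ← abs_mul]
    congr 1
    nlinarith [Real.sq_sqrt ha, Real.sq_sqrt hb]
  rw [h, ← sq_abs, sq]
  gcongr
  rw [abs_le]
  constructor <;> linarith [Real.sqrt_nonneg a, Real.sqrt_nonneg b]

/-- The characteristic function of a finite set, as an element of the group algebra. -/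
def charFun {X : Type*} (A : Finset X) : MonoidAlgebra ℂ X :=
  .ofCoeff (Finsupp.indicator A fun _ _ => 1)

theorem sum_charFun {X M : Type*} [AddCommMonoid M] (A : Finset X) (h : X → ℂ → M)
    (h0 : ∀ x, h x 0 = 0) : (charFun A).coeff.sum h = ∑ x ∈ A, h x 1 := by
  rw [charFun, MonoidAlgebra.coeff_ofCoeff, Finsupp.sum_of_support_subset _
    (Finsupp.support_indicator_subset A _) h fun x _ => h0 x]
  exact Finset.sum_congr rfl fun x hx => by rw [Finsupp.indicator_of_mem hx]

theorem twoNorm_charFun {X : Type*} (A : Finset X) : twoNorm (charFun A) = √A.card := by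
  rw [twoNorm, sum_charFun A _ (by simp)]
  simp

theorem charFun_ne_zero {X : Type*} {A : Finset X} (hA : A.Nonempty) : charFun A ≠ 0 := by
  obtain ⟨x, hx⟩ := hA
  intro h
  have : (charFun A).coeff x = 1 := by
    rw [charFun, MonoidAlgebra.coeff_ofCoeff, Finsupp.indicator_of_mem hx]
  simp [h] at this

/-- For a finite subset `A` of an amenable subgroup, the norm of `λ(1_A)` is at least `|A|`: the
square roots of almost invariant probability measures are almost fixed by `λ_s`, for `s ∈ A`. -/
theorem IsAmenable.card_le_norm {N : Subgroup Γ} (hN : IsAmenable N) {A : Finset Γ}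
    (hA : (A : Set Γ) ⊆ N) : (A.card : ℝ) ≤ ‖regRepAlg (charFun A)‖ := by
  refine le_of_forall_pos_le_add fun ε hε => ?_
  set r : ℝ := ε / (A.card + 1) with hr
  have hr0 : 0 < r := by positivity
  obtain ⟨p, hp0, hp1, hp⟩ := hN.exists_almost_invariant hA (pow_pos hr0 2)
  have hsq (x : Γ) : ‖((√(p x) : ℝ) : ℂ)‖ ^ 2 = p x := by
    rw [Complex.norm_real, Real.norm_eq_abs, sq_abs, Real.sq_sqrt (hp0 x)]
  let η : lp (fun _ : Γ => ℂ) 2 := ⟨fun x => (√(p x) : ℝ), memℓp_gen (by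
    simpa only [ENNReal.toReal_ofNat, Real.rpow_two, hsq] using hp1.summable)⟩
  have hη : ‖η‖ = 1 := by
    have : ‖η‖ ^ 2 = 1 := by
      rw [norm_sq_eq_tsum, ← hp1.tsum_eq]
      exact tsum_congr hsq
    exact (pow_eq_one_iff_of_nonneg (norm_nonneg η) two_ne_zero).1 this
  have hs (s : Γ) (h : s ∈ A) : ‖regRep s η - η‖ ≤ r := by
    refine le_of_sq_le_sq ?_ hr0.le
    rw [norm_sq_eq_tsum]
    have hle (x : Γ) : ‖(regRep s η - η) x‖ ^ 2 ≤ |p (s⁻¹ * x) - p x| := by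
      change ‖((√(p (s⁻¹ * x)) : ℝ) : ℂ) - ((√(p x) : ℝ) : ℂ)‖ ^ 2 ≤ _
      rw [← Complex.ofReal_sub, Complex.norm_real, Real.norm_eq_abs, sq_abs]
      exact sq_sqrt_sub_sqrt_le (hp0 _) (hp0 _)
    refine le_trans (Summable.tsum_le_tsum hle ?_ (hp s h).1) (hp s h).2
    exact (hp s h).1.of_nonneg_of_le (fun x => by positivity) hle
  have hT : regRepAlg (charFun A) η = ∑ s ∈ A, regRep s η := by
    rw [regRepAlg, sum_charFun A _ (by simp), _root_.sum_apply]
    simp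
  have hη' : (A.card : ℂ) • η = regRepAlg (charFun A) η - ∑ s ∈ A, (regRep s η - η) := by
    rw [hT, Finset.sum_sub_distrib, Finset.sum_const, sub_sub_cancel, Nat.cast_smul_eq_nsmul]
  calc (A.card : ℝ) = ‖(A.card : ℂ) • η‖ := by rw [norm_smul, hη]; simp
    _ ≤ ‖regRepAlg (charFun A) η‖ + ‖∑ s ∈ A, (regRep s η - η)‖ := by
      rw [hη']
      exact norm_sub_le _ _
    _ ≤ ‖regRepAlg (charFun A)‖ + ε := by
      gcongr
      · simpa [hη] using (regRepAlg (charFun A)).le_opNorm η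
      · refine (norm_sum_le_of_le A hs).trans ?_
        rw [Finset.sum_const, nsmul_eq_mul, hr, mul_div_assoc', div_le_iff₀ (by positivity)]
        nlinarith

theorem norm_regRepAlg_le (f : MonoidAlgebra ℂ Γ) :
    ‖regRepAlg f‖ ≤ √f.coeff.support.card * twoNorm f := by
  have h1 : ‖regRepAlg f‖ ≤ ∑ x ∈ f.coeff.support, ‖f.coeff x‖ := by
    refine norm_sum_le_of_le _ fun x _ => ?_
    rw [norm_smul]
    exact mul_le_of_le_one_right (norm_nonneg _) (LinearIsometry.norm_toContinuousLinearMap_le _)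
  refine h1.trans ?_
  rw [twoNorm, ← Real.sqrt_mul (Nat.cast_nonneg _)]
  exact Real.le_sqrt_of_sq_le sq_sum_le_card_mul_sum_sq

/-- The set of quotients defining `rho S n` is bounded, so `rho S n` is an honest supremum. -/
theorem norm_div_twoNorm_le_rho {n : ℕ} {f : MonoidAlgebra ℂ Γ} (hf : f ≠ 0)
    (hsupp : (f.coeff.support : Set Γ) ⊆ ball S n) : ‖regRepAlg f‖ / twoNorm f ≤ rho S n := by
  refine le_csSup ⟨√(ball_finite S n).toFinset.card, ?_⟩ ⟨f, hf, hsupp, rfl⟩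
  rintro _ ⟨f, -, hsupp, rfl⟩
  refine div_le_of_le_mul₀ (Real.sqrt_nonneg _) (Real.sqrt_nonneg _) ?_
  refine (norm_regRepAlg_le f).trans (mul_le_mul_of_nonneg_right ?_ (Real.sqrt_nonneg _))
  refine Real.sqrt_le_sqrt (Nat.cast_le.2 (Finset.card_le_card fun x hx => ?_))
  exact (ball_finite S n).mem_toFinset.2 (hsupp hx)

theorem rho_nonneg (S : Finset Γ) (n : ℕ) : 0 ≤ rho S n :=
  Real.sSup_nonneg (by
    rintro _ ⟨f, -, -, rfl⟩
    exact div_nonneg (norm_nonneg _) (Real.sqrt_nonneg _))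

theorem IsAmenable.growth_le_rho_sq {N : Subgroup Γ} (hN : IsAmenable N) {A : Set Γ}
    (hA : A ⊆ N) (n : ℕ) : growth S A n ≤ rho S n ^ 2 := by
  have hfin : (A ∩ ball S n).Finite := (ball_finite S n).inter_of_right _
  rw [growth, Set.ncard_eq_toFinset_card _ hfin]
  rcases hfin.toFinset.eq_empty_or_nonempty with h | h
  · rw [h]
    simpa using sq_nonneg (rho S n)
  · have hpos : (0 : ℝ) < hfin.toFinset.card := by exact_mod_cast h.card_pos
    have h1 := hN.card_le_norm (A := hfin.toFinset) fun x hx => hA (hfin.mem_toFinset.1 hx).1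
    have h2 : ‖regRepAlg (charFun hfin.toFinset)‖ / twoNorm (charFun hfin.toFinset) ≤ rho S n := by
      refine norm_div_twoNorm_le_rho (charFun_ne_zero h) fun x hx => ?_
      exact (hfin.mem_toFinset.1 (Finsupp.support_indicator_subset _ _ hx)).2
    rw [twoNorm_charFun, div_le_iff₀ (Real.sqrt_pos.2 hpos)] at h2
    refine (Real.sqrt_le_left (rho_nonneg S n)).1 ?_
    refine le_of_mul_le_mul_right ?_ (Real.sqrt_pos.2 hpos)
    rw [Real.mul_self_sqrt hpos.le]
    exact h1.trans h2

/-- Every element of the amenable radical lies in an amenable normal subgroup. -/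
theorem exists_of_mem_amenableRadical {g : Γ} (hg : g ∈ amenableRadical Γ) :
    ∃ N : Subgroup Γ, N.Normal ∧ IsAmenable N ∧ g ∈ N := by
  rw [amenableRadical, Subgroup.mem_sSup_of_directedOn] at hg
  · obtain ⟨N, ⟨h1, h2⟩, h3⟩ := hg
    exact ⟨N, h1, h2, h3⟩
  · exact ⟨⊥, inferInstance, IsAmenable.of_comm fun a b => Subsingleton.elim _ _⟩
  · rintro H ⟨h1, h2⟩ N ⟨h3, h4⟩
    exact ⟨H ⊔ N, ⟨inferInstance, h2.sup h4⟩, le_sup_left, le_sup_right⟩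

theorem growth_conjugatesOf_le_rho_sq {g : Γ} (hg : g ∈ amenableRadical Γ) (n : ℕ) :
    growth S (conjugatesOf g) n ≤ rho S n ^ 2 := by
  obtain ⟨N, hN, hamen, hgN⟩ := exists_of_mem_amenableRadical hg
  refine hamen.growth_le_rho_sq (fun x hx => ?_) n
  obtain ⟨c, rfl⟩ := isConj_iff.1 hx
  exact hN.conj_mem g hgN c

end Kesten

end RapidDecay

end

theorem mainTheorem6 {Γ : Type*} [Group Γ] (S : Finset Γ)
    (hsymm : ∀ s ∈ S, s⁻¹ ∈ S) (hgen : Subgroup.closure (S : Set Γ) = ⊤) :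
    (RapidDecay.HasSRD S → RapidDecay.SEC S = (RapidDecay.amenableRadical Γ : Set Γ)) ∧
    (RapidDecay.HasRD S →
      RapidDecay.PC S = RapidDecay.SEC S ∧
      RapidDecay.SEC S = (RapidDecay.amenableRadical Γ : Set Γ)) := by
  have h1 := RapidDecay.SEC_subset_amenableRadical hsymm hgen
  have h2 := RapidDecay.PC_subset_SEC S
  refine ⟨fun h => h1.antisymm fun g hg => ?_, fun h => ?_⟩
  · have hsq := RapidDecay.GrowsSubexponentially.comp_linear_pow h (RapidDecay.rho_nonneg S) 1 0 2
    refine hsq.mono fun n => ?_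
    simpa using RapidDecay.growth_conjugatesOf_le_rho_sq hg n
  · have h3 : (RapidDecay.amenableRadical Γ : Set Γ) ⊆ RapidDecay.PC S := fun g hg =>
      (RapidDecay.GrowsPolynomially.pow h (RapidDecay.rho_nonneg S) 2).mono
        (RapidDecay.growth_conjugatesOf_le_rho_sq hg)
    exact ⟨h2.antisymm (h1.trans h3), h1.antisymm (h3.trans h2)⟩
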